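/- For complex $A,p$ put $(A;p)_n=\prod_{k=0}^{n-1}(1-Ap^k)$ and, for $|p|<1$, $(A;p)_\infty=\prod_{k=0}^{\infty}(1-Ap^k)$, and write $(A_1,\dots,A_j;p)_n=(A_1;p)_n\cdots(A_j;p)_n$ (also for $n=\infty$). Theorem. Let $m$ be a positive integer and let $z,q\in\mathbb C$ with $z\neq 0$, $q\ne 0$ and $|q|<1$. Then $$\sum_{r=0}^{m-1}q^{3r(r-1)/2}z^r\sum_{n=0}^{\infty}\frac{q^{m^2n^2}\left(-q^{m^2/2}z^mq^{3m(r-1/2)},\ \dfrac{-q^{m^2/2}}{z^mq^{3m(r-1/2)}};\,q^{m^2}\right)_n}{(q^{m^2};q^{m^2})_{2n}}=\frac{(-z,-q^3/z,q^3;q^3)_\infty}{(q^{m^2};q^{m^2})_\infty},$$ where each of the $m$ inner series converges absolutely. Half-integral powers of $q$ are the corresponding powers of an arbitrary fixed square root $q^{1/2}$ of $q$; the choice does not matter. The case $m=1$ (with $q=x^2$, $z=ax^3$) is Ramanujan's identity, valid for all $x,a\in\mathbb C$ with $|x|<1$ and $a\neq0$ (trivially for $x=0$): $$\sum_{n=0}^\infty\frac{x^{2n^2}(-ax;x^2)_n(-x/a;x^2)_n}{(x^2;x^2)_{2n}}=\frac{(-ax^3,-x^3/a,x^6;x^6)_\infty}{(x^2;x^2)_\infty},$$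 the series again converging absolutely. -/

import Mathlib

/-- The finite rising `q`-factorial `(A; q)_n = (1 - A) (1 - A q) ⋯ (1 - A q ^ (n - 1))`. -/
noncomputable def qPoch (A q : ℂ) (n : ℕ) : ℂ :=
  ∏ k ∈ Finset.range n, (1 - A * q ^ k)

/-- The infinite rising `q`-factorial `(A; q)_∞ = ∏_{k ≥ 0} (1 - A q ^ k)`. -/
noncomputable def qPochInf (A q : ℂ) : ℂ :=
  ∏' k : ℕ, (1 - A * q ^ k)

/-- For `|q| < 1` the product defining `(A; q)_∞` converges, so `qPochInf` is its true value. -/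
theorem multipliable_qPochInf (A : ℂ) {q : ℂ} (hq : ‖q‖ < 1) :
    Multipliable fun k : ℕ => 1 - A * q ^ k := by
  have h : Summable fun k : ℕ => ‖-(A * q ^ k)‖ := by
    simp only [norm_neg, norm_mul, norm_pow]
    exact (summable_geometric_of_lt_one (norm_nonneg q) hq).mul_left ‖A‖
  simpa [sub_eq_add_neg] using multipliable_one_add_of_summable h

/-- The parameter `A_r = q ^ (m ^ 2 / 2) * z ^ m * q ^ (3 m (r - 1 / 2))`, written with
`s = q ^ (1 / 2)`. -/
noncomputable def paramA (m : ℕ) (s z : ℂ) (r : ℕ) : ℂ :=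
  s ^ (m ^ 2) * z ^ m * s ^ (3 * (m : ℤ) * (2 * (r : ℤ) - 1))

/-- The parameter `B_r = q ^ (m ^ 2 / 2) / (z ^ m * q ^ (3 m (r - 1 / 2)))`, written with
`s = q ^ (1 / 2)`. -/
noncomputable def paramB (m : ℕ) (s z : ℂ) (r : ℕ) : ℂ :=
  s ^ (m ^ 2) / (z ^ m * s ^ (3 * (m : ℤ) * (2 * (r : ℤ) - 1)))

/-- The `n`-th term of the inner series,
`q ^ (m² n²) (-A_r, -B_r; q ^ m²)_n / (q ^ m²; q ^ m²)_{2 n}`. -/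
noncomputable def innerTerm (m : ℕ) (q s z : ℂ) (r n : ℕ) : ℂ :=
  q ^ (m ^ 2 * n ^ 2) *
      (qPoch (-paramA m s z r) (q ^ (m ^ 2)) n * qPoch (-paramB m s z r) (q ^ (m ^ 2)) n) /
    qPoch (q ^ (m ^ 2)) (q ^ (m ^ 2)) (2 * n)

/-- The `n`-th term `x ^ (2 n²) (-a x; x²)_n (-x / a; x²)_n / (x²; x²)_{2 n}` of Ramanujan's
series. -/
noncomputable def ramanujanTerm (x a : ℂ) (n : ℕ) : ℂ :=
  x ^ (2 * n ^ 2) * qPoch (-(a * x)) (x ^ 2) n * qPoch (-(x / a)) (x ^ 2) n /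
    qPoch (x ^ 2) (x ^ 2) (2 * n)

open Filter Topology

/-! Put `p = x ^ 2`. The finite Jacobi triple product expands the quotient in Ramanujan's series as
`∑ x ^ (k²) a ^ k / ((p; p)_{n+k} (p; p)_{n-k})` over `k` (`hasSum_thetaTerm_mul_invQFact`). After
multiplying by `p ^ (n²)` and summing over `n` first, Cauchy's identity turns the inner sum into `p
^ (k²) / (p; p)_∞` (`tsum_pow_sq_mul_invQFact`). Since `x ^ (k²) p ^ (k²) = (x ^ 3) ^ (k²)`, a theta
series in `x ^ 3` remains, and the triple product sums it.

For general `m`, the theta series `∑ q ^ (3N(N-1)/2) z ^ N` is split by `N` mod `m`. Each residue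
class is again a theta series, to which Ramanujan's identity applies with `x = s ^ (m²)`. -/

theorem qPoch_succ (A q : ℂ) (n : ℕ) : qPoch A q (n + 1) = qPoch A q n * (1 - A * q ^ n) :=
  Finset.prod_range_succ _ _

theorem tendsto_qPoch (A : ℂ) {q : ℂ} (hq : ‖q‖ < 1) :
    Tendsto (qPoch A q) atTop (𝓝 (qPochInf A q)) :=
  (multipliable_qPochInf A hq).hasProd.tendsto_prod_nat

theorem one_sub_pow_succ_ne_zero {p : ℂ} (hp : ‖p‖ < 1) (n : ℕ) : 1 - p * p ^ n ≠ 0 := by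
  rw [← pow_succ', sub_ne_zero]
  intro h
  have h' := congrArg norm h
  rw [norm_one, norm_pow] at h'
  exact (pow_lt_one₀ (norm_nonneg p) hp n.succ_ne_zero).ne h'.symm

theorem qPoch_self_ne_zero {p : ℂ} (hp : ‖p‖ < 1) (n : ℕ) : qPoch p p n ≠ 0 :=
  Finset.prod_ne_zero_iff.2 fun k _ => one_sub_pow_succ_ne_zero hp k

theorem qPochInf_self_ne_zero {p : ℂ} (hp : ‖p‖ < 1) : qPochInf p p ≠ 0 := by
  have h : Summable fun k : ℕ => ‖-(p * p ^ k)‖ := by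
    simp only [norm_neg, norm_mul, norm_pow]
    exact (summable_geometric_of_lt_one (norm_nonneg p) hp).mul_left ‖p‖
  have := tprod_one_add_ne_zero_of_summable (f := fun k : ℕ => -(p * p ^ k))
    (fun k => by simpa [sub_eq_add_neg] using one_sub_pow_succ_ne_zero hp k) h
  simpa [qPochInf, sub_eq_add_neg] using this

/-- The reciprocal `1 / (p; p)_i`, extended by zero to negative `i`. -/
noncomputable def invQFact (p : ℂ) (i : ℤ) : ℂ :=
  if 0 ≤ i then (qPoch p p i.toNat)⁻¹ else 0

theorem invQFact_natCast (p : ℂ) (n : ℕ) : invQFact p n = (qPoch p p n)⁻¹ := by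
  simp [invQFact]

theorem invQFact_of_neg (p : ℂ) {i : ℤ} (hi : i < 0) : invQFact p i = 0 :=
  if_neg hi.not_ge

/-- The extension by zero respects the recurrence because the factor `1 - p ^ i` vanishes at `i =
0`. Inductions over `n` therefore need no boundary cases in `k`. -/
theorem invQFact_sub_one {p : ℂ} (hp : ‖p‖ < 1) (i : ℤ) :
    invQFact p (i - 1) = (1 - p ^ i) * invQFact p i := by
  rcases lt_trichotomy i 0 with hi | rfl | hi
  · rw [invQFact_of_neg p hi, invQFact_of_neg p (by omega), mul_zero]
  · simp [invQFact]
  · obtain ⟨n, rfl⟩ : ∃ n : ℕ, i = (n + 1 : ℕ) := ⟨(i - 1).toNat, by omega⟩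
    rw [show ((n + 1 : ℕ) : ℤ) - 1 = (n : ℕ) by push_cast; ring, invQFact_natCast,
      invQFact_natCast, qPoch_succ, zpow_natCast, mul_inv, ← pow_succ']
    have := one_sub_pow_succ_ne_zero hp n
    rw [← pow_succ'] at this
    field_simp

theorem tendsto_inv_qPoch {p : ℂ} (hp : ‖p‖ < 1) :
    Tendsto (fun n => (qPoch p p n)⁻¹) atTop (𝓝 (qPochInf p p)⁻¹) :=
  (tendsto_qPoch p hp).inv₀ (qPochInf_self_ne_zero hp)

theorem tendsto_invQFact {p : ℂ} (hp : ‖p‖ < 1) {u : ℕ → ℤ} (hu : Tendsto u atTop atTop) :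
    Tendsto (fun n => invQFact p (u n)) atTop (𝓝 (qPochInf p p)⁻¹) := by
  have h : Tendsto (fun n => (u n).toNat) atTop atTop := by
    refine tendsto_atTop.2 fun b => ?_
    filter_upwards [hu.eventually_ge_atTop (b : ℤ)] with n hn
    omega
  refine ((tendsto_inv_qPoch hp).comp h).congr' ?_
  filter_upwards [hu.eventually_ge_atTop 0] with n hn
  simp [invQFact, hn]

theorem exists_norm_inv_qPoch_le {p : ℂ} (hp : ‖p‖ < 1) :
    ∃ C : ℝ, 0 ≤ C ∧ ∀ n, ‖(qPoch p p n)⁻¹‖ ≤ C := by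
  obtain ⟨C, hC⟩ := (tendsto_inv_qPoch hp).norm.bddAbove_range
  have h : ∀ n, ‖(qPoch p p n)⁻¹‖ ≤ C := fun n => hC ⟨n, rfl⟩
  exact ⟨C, (norm_nonneg _).trans (h 0), h⟩

theorem exists_norm_invQFact_le {p : ℂ} (hp : ‖p‖ < 1) :
    ∃ C : ℝ, 0 ≤ C ∧ ∀ i, ‖invQFact p i‖ ≤ C := by
  obtain ⟨C, h0, hC⟩ := exists_norm_inv_qPoch_le hp
  refine ⟨C, h0, fun i => ?_⟩
  unfold invQFact
  split_ifs
  · exact hC _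
  · simpa using h0

/-! ### Cauchy's identity -/

/-- The `j`-th term of Cauchy's series for `1 / (p; p)_∞`. -/
noncomputable def cauchyTerm (p : ℂ) (c j : ℕ) : ℂ :=
  p ^ (j * (j + c)) * ((qPoch p p j)⁻¹ * (qPoch p p (j + c))⁻¹)

theorem exists_norm_cauchyTerm_le {p : ℂ} (hp : ‖p‖ < 1) :
    ∃ C : ℝ, ∀ c j, ‖cauchyTerm p c j‖ ≤ C * ‖p‖ ^ j := by
  obtain ⟨C, h0, hC⟩ := exists_norm_inv_qPoch_le hp
  refine ⟨C * C, fun c j => ?_⟩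
  rw [cauchyTerm, norm_mul, norm_mul, norm_pow, mul_comm]
  have : ‖p‖ ^ (j * (j + c)) ≤ ‖p‖ ^ j :=
    pow_le_pow_of_le_one (norm_nonneg p) hp.le (by nlinarith [Nat.le_mul_self j, Nat.zero_le (j * c)])
  have h1 := hC j
  have h2 := hC (j + c)
  gcongr

theorem summable_cauchyTerm {p : ℂ} (hp : ‖p‖ < 1) (c : ℕ) : Summable (cauchyTerm p c) := by
  obtain ⟨C, hC⟩ := exists_norm_cauchyTerm_le hp
  exact .of_norm_bounded ((summable_geometric_of_lt_one (norm_nonneg p) hp).mul_left C) (hC c)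

/-- Telescoping: in the limit `N → ∞` this makes the sum of Cauchy's series independent of `c`. -/
theorem sum_range_cauchyTerm_sub {p : ℂ} (hp : ‖p‖ < 1) (c N : ℕ) :
    ∑ j ∈ Finset.range N, (cauchyTerm p c j - cauchyTerm p (c + 1) j) =
      -(1 - p ^ N) * cauchyTerm p c N := by
  induction N with
  | zero => simp
  | succ N ih =>
    rw [Finset.sum_range_succ, ih]
    have h1 := one_sub_pow_succ_ne_zero hp N
    have h2 := one_sub_pow_succ_ne_zero hp (N + c)
    have h3 := one_sub_pow_succ_ne_zero hp (N + c + 1)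
    have h4 := qPoch_self_ne_zero hp N
    have h5 := qPoch_self_ne_zero hp (N + c)
    simp only [cauchyTerm]
    rw [show N + 1 + c = N + c + 1 by ring, show N + (c + 1) = N + c + 1 by ring,
      show N * (N + c + 1) = N * (N + c) + N by ring,
      show (N + 1) * (N + c + 1) = N * (N + c) + (N + (N + c) + 1) by ring]
    simp only [qPoch_succ]
    generalize qPoch p p N = u at *
    generalize qPoch p p (N + c) = v at *
    rw [pow_add p (N * (N + c)), pow_add p (N * (N + c)), pow_succ p (N + (N + c)), pow_add p N (N + c), pow_succ p N]
    generalize p ^ (N * (N + c)) = w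
    generalize p ^ (N + c) = y at *
    generalize p ^ N = t at *
    have h6 : 1 - t * p ≠ 0 := by rwa [mul_comm]
    field_simp
    ring

theorem tsum_cauchyTerm_succ {p : ℂ} (hp : ‖p‖ < 1) (c : ℕ) :
    ∑' j, cauchyTerm p (c + 1) j = ∑' j, cauchyTerm p c j := by
  have h1 := ((summable_cauchyTerm hp c).sub (summable_cauchyTerm hp (c + 1))).hasSum.tendsto_sum_nat
  have h2 : Tendsto (fun N => -(1 - p ^ N) * cauchyTerm p c N) atTop (𝓝 (-(1 - 0) * 0)) :=
    ((tendsto_pow_atTop_nhds_zero_of_norm_lt_one hp).const_sub 1).neg.mul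
      (summable_cauchyTerm hp c).tendsto_atTop_zero
  simp only [sum_range_cauchyTerm_sub hp] at h1
  have h3 := tendsto_nhds_unique h1 h2
  rw [(summable_cauchyTerm hp c).tsum_sub (summable_cauchyTerm hp (c + 1)), mul_zero] at h3
  exact (sub_eq_zero.1 h3).symm

/-- Cauchy's identity (the Durfee rectangle dissection). -/
theorem tsum_cauchyTerm {p : ℂ} (hp : ‖p‖ < 1) (c : ℕ) :
    ∑' j, cauchyTerm p c j = (qPochInf p p)⁻¹ := by
  have hconst : ∀ c, ∑' j, cauchyTerm p c j = ∑' j, cauchyTerm p 0 j := fun c => by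
    induction c with
    | zero => rfl
    | succ c ih => rw [tsum_cauchyTerm_succ hp, ih]
  obtain ⟨C, hC⟩ := exists_norm_cauchyTerm_le hp
  -- The constant value is found by letting `c → ∞`: the factor `p ^ (j * c)` kills every term but
  -- `j = 0`.
  have hlim : Tendsto (fun c => ∑' j, cauchyTerm p c j) atTop
      (𝓝 (∑' j : ℕ, if j = 0 then (qPochInf p p)⁻¹ else 0)) := by
    refine tendsto_tsum_of_dominated_convergence
      ((summable_geometric_of_lt_one (norm_nonneg p) hp).mul_left C) (fun j => ?_)
      (.of_forall fun c j => hC c j)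
    have hj := (tendsto_inv_qPoch hp).comp (tendsto_add_atTop_nat j)
    split_ifs with h
    · subst h
      simpa [cauchyTerm, qPoch] using tendsto_inv_qPoch hp
    · have hpj : ‖p ^ j‖ < 1 := by
        rw [norm_pow]
        exact pow_lt_one₀ (norm_nonneg p) hp h
      have := (((tendsto_pow_atTop_nhds_zero_of_norm_lt_one hpj).const_mul (p ^ (j * j))).mul
        (hj.const_mul (qPoch p p j)⁻¹))
      rw [mul_zero, zero_mul] at this
      refine this.congr fun c => ?_
      simp only [cauchyTerm, Function.comp, add_comm c j, mul_add, pow_add, pow_mul]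
  rw [tsum_ite_eq] at hlim
  simp only [hconst] at hlim
  rw [hconst, tendsto_nhds_unique tendsto_const_nhds hlim]

/-- By symmetry `k` may be replaced by `K = |k|`. Terms with `n < K` vanish, and `n = j + K` gives
`n² = K² + j (j + 2K)`, which is Cauchy's series with `c = 2K`. -/
theorem tsum_pow_sq_mul_invQFact {p : ℂ} (hp : ‖p‖ < 1) (k : ℤ) :
    ∑' n : ℕ, p ^ (n * n) * (invQFact p (n + k) * invQFact p (n - k)) =
      p ^ (k.natAbs * k.natAbs) * (qPochInf p p)⁻¹ := by
  obtain ⟨K, hK⟩ : ∃ K : ℕ, K = k.natAbs := ⟨_, rfl⟩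
  have hsymm : ∀ n : ℕ, invQFact p (n + k) * invQFact p (n - k) =
      invQFact p (n + K) * invQFact p (n - K) := fun n => by
    rcases Int.natAbs_eq k with h | h
    · rw [h, ← hK]
    · rw [h, ← hK, sub_neg_eq_add, ← sub_eq_add_neg, mul_comm]
  simp only [hsymm, ← hK]
  have hsupp : Function.support
      (fun n : ℕ => p ^ (n * n) * (invQFact p (n + K) * invQFact p (n - K))) ⊆
      Set.range (fun j : ℕ => j + K) := fun n hn => by
    by_contra h
    refine hn ?_
    have : n < K := by
      by_contra h'
      exact h ⟨n - K, by simp only; omega⟩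
    simp only
    rw [invQFact_of_neg p (by omega : (n : ℤ) - K < 0), mul_zero, mul_zero]
  rw [← (add_left_injective K).tsum_eq hsupp, ← tsum_cauchyTerm hp (K + K), ← tsum_mul_left]
  refine tsum_congr fun j => ?_
  rw [show ((j + K : ℕ) : ℤ) + K = (j + (K + K) : ℕ) by push_cast; ring,
    show ((j + K : ℕ) : ℤ) - K = (j : ℕ) by push_cast; ring, invQFact_natCast, invQFact_natCast,
    cauchyTerm]
  ring

/-! ### Theta series and the Jacobi triple product -/

/-- The term `x ^ (k²) a ^ k` of the theta series. -/
noncomputable def thetaTerm (x a : ℂ) (k : ℤ) : ℂ :=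
  x ^ (k * k) * a ^ k

theorem summable_pow_sq_mul_pow {x : ℂ} (hx : ‖x‖ < 1) (a : ℂ) :
    Summable fun n : ℕ => x ^ (n * n) * a ^ n := by
  have h : Tendsto (fun n : ℕ => ‖x ^ n * a‖) atTop (𝓝 0) := by
    simpa using ((tendsto_pow_atTop_nhds_zero_of_norm_lt_one hx).mul_const a).norm
  refine .of_norm_bounded_eventually_nat (g := fun n : ℕ => (1 / 2 : ℝ) ^ n)
    (summable_geometric_of_lt_one (by norm_num) (by norm_num)) ?_
  filter_upwards [h.eventually_le_const (by norm_num : (0 : ℝ) < 1 / 2)] with n hn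
  rw [pow_mul, ← mul_pow, norm_pow]
  exact pow_le_pow_left₀ (norm_nonneg _) hn n

theorem summable_thetaTerm {x : ℂ} (hx : ‖x‖ < 1) (a : ℂ) : Summable (thetaTerm x a) := by
  refine .of_nat_of_neg ?_ ?_
  · refine (summable_pow_sq_mul_pow hx a).congr fun n => ?_
    rw [thetaTerm, zpow_natCast, ← Nat.cast_mul, zpow_natCast]
  · refine (summable_pow_sq_mul_pow hx a⁻¹).congr fun n => ?_
    rw [thetaTerm, neg_mul_neg, ← Nat.cast_mul, zpow_natCast, zpow_neg, zpow_natCast, inv_pow]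

theorem thetaTerm_add_one {x a : ℂ} (hx : x ≠ 0) (ha : a ≠ 0) (k : ℤ) :
    thetaTerm x a (k + 1) = thetaTerm x a k * ((x ^ k) ^ 2 * x * a) := by
  rw [thetaTerm, thetaTerm, show (k + 1) * (k + 1) = k * k + (k + k + 1) by ring, zpow_add₀ hx,
    zpow_add₀ hx, zpow_add₀ hx, zpow_add₀ ha, zpow_one, zpow_one]
  ring

theorem thetaTerm_sub_one {x a : ℂ} (hx : x ≠ 0) (ha : a ≠ 0) (k : ℤ) :
    thetaTerm x a (k - 1) = thetaTerm x a k * (x / ((x ^ k) ^ 2 * a)) := by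
  rw [thetaTerm, thetaTerm, show (k - 1) * (k - 1) = k * k + (-k + -k + 1) by ring, zpow_add₀ hx,
    zpow_add₀ hx, zpow_add₀ hx, zpow_sub₀ ha, zpow_one, zpow_one, zpow_neg]
  field_simp

/-- The finite form of the Jacobi triple product, divided by `(x²; x²)_{2n}`. -/
theorem hasSum_thetaTerm_mul_invQFact {x a : ℂ} (hx : ‖x‖ < 1) (hx0 : x ≠ 0) (ha : a ≠ 0) (n : ℕ) :
    HasSum (fun k : ℤ =>
        thetaTerm x a k * (invQFact (x ^ 2) (n + k) * invQFact (x ^ 2) (n - k)))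
      (qPoch (-(a * x)) (x ^ 2) n * qPoch (-(x / a)) (x ^ 2) n / qPoch (x ^ 2) (x ^ 2) (2 * n)) := by
  have hp : ‖x ^ 2‖ < 1 := by
    rw [norm_pow]
    exact pow_lt_one₀ (norm_nonneg x) hx two_ne_zero
  have hp0 : x ^ 2 ≠ 0 := pow_ne_zero 2 hx0
  induction n with
  | zero =>
    convert hasSum_single (0 : ℤ) fun k hk => ?_ using 1
    · simp [thetaTerm, invQFact, qPoch]
    · rcases lt_or_gt_of_ne hk with h | h
      · rw [invQFact_of_neg _ (by simpa using h), zero_mul, mul_zero]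
      · rw [invQFact_of_neg _ (i := ((0 : ℕ) : ℤ) - k) (by simpa using h), mul_zero, mul_zero]
  | succ n ih =>
    -- The new factors multiply to `1 + x ^ (4n+2) + x ^ (2n+1) (a + 1/a)`; the powers `a` and `1/a`
    -- shift the index `k` by one.
    have hl := ((Equiv.subRight (1 : ℤ)).hasSum_iff.2 ih).mul_left (x ^ (2 * n + 1) * a)
    have hr := ((Equiv.addRight (1 : ℤ)).hasSum_iff.2 ih).mul_left (x ^ (2 * n + 1) / a)
    have hc := ih.mul_left (1 + (x ^ (2 * n + 1)) ^ 2)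
    have h1 := one_sub_pow_succ_ne_zero hp (2 * n)
    have h2 := one_sub_pow_succ_ne_zero hp (2 * n + 1)
    have key := ((hc.add (hl.add hr)).mul_left
      ((1 - x ^ 2 * (x ^ 2) ^ (2 * n)) * (1 - x ^ 2 * (x ^ 2) ^ (2 * n + 1)))⁻¹)
    refine Eq.subst (motive := HasSum _) ?_
      (Eq.subst (motive := fun f => HasSum f _) (funext fun k => ?_) key)
    rotate_left
    · simp only [Function.comp, Equiv.subRight_apply, Equiv.coe_addRight]
      rw [thetaTerm_add_one hx0 ha, thetaTerm_sub_one hx0 ha]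
      -- All reciprocals are expressed through those at `n + 1 + k` and `n + 1 - k`, so that
      -- comparing coefficients becomes a rational identity.
      have e1 : invQFact (x ^ 2) (n + k) =
          (1 - (x ^ 2) ^ (n + 1 + k : ℤ)) * invQFact (x ^ 2) (n + 1 + k) := by
        rw [← invQFact_sub_one hp]; congr 1; ring
      have e2 : invQFact (x ^ 2) (n + (k - 1)) =
          (1 - (x ^ 2) ^ (n + k : ℤ)) * invQFact (x ^ 2) (n + k) := by
        rw [← invQFact_sub_one hp]; congr 1; ring
      have e3 : invQFact (x ^ 2) (n - k) =
          (1 - (x ^ 2) ^ (n + 1 - k : ℤ)) * invQFact (x ^ 2) (n + 1 - k) := by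
        rw [← invQFact_sub_one hp]; congr 1; ring
      have e4 : invQFact (x ^ 2) (n - (k + 1)) =
          (1 - (x ^ 2) ^ (n - k : ℤ)) * invQFact (x ^ 2) (n - k) := by
        rw [← invQFact_sub_one hp]; congr 1; ring
      rw [show (n : ℤ) + (k + 1) = n + 1 + k by ring, show (n : ℤ) - (k - 1) = n + 1 - k by ring,
        e2, e4, e1, e3]
      push_cast
      generalize invQFact (x ^ 2) (n + 1 + k) = R
      generalize invQFact (x ^ 2) (n + 1 - k) = S
      generalize thetaTerm x a k = T
      have hy : x ^ k ≠ 0 := zpow_ne_zero k hx0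
      have hz : (x ^ 2) ^ k = (x ^ k) ^ 2 := by
        rw [← zpow_natCast, ← zpow_natCast, ← zpow_mul, ← zpow_mul, mul_comm]
      rw [zpow_sub₀ hp0, zpow_sub₀ hp0, zpow_add₀ hp0 (n + 1 : ℤ), zpow_add₀ hp0 (n : ℤ) k,
        zpow_add₀ hp0 (n : ℤ) 1, zpow_one, zpow_natCast, hz]
      have hm : (x ^ 2) ^ (2 * n) = (x ^ n) ^ 4 := by ring
      rw [pow_succ (x ^ 2), hm] at h2
      rw [hm] at h1
      rw [pow_succ (x ^ 2), hm, show (x ^ 2) ^ n = (x ^ n) ^ 2 by ring,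
        show x ^ (2 * n + 1) = (x ^ n) ^ 2 * x by ring, inv_mul_eq_div, div_eq_iff (mul_ne_zero h1 h2)]
      generalize x ^ k = y at *
      generalize x ^ n = X at *
      field_simp
      ring
    · rw [show 2 * (n + 1) = 2 * n + 1 + 1 by ring]
      simp only [qPoch_succ]
      have h3 := qPoch_self_ne_zero hp (2 * n)
      rw [show x ^ (2 * n + 1) = (x ^ 2) ^ n * x by ring]
      generalize 1 - x ^ 2 * (x ^ 2) ^ (2 * n) = u at *
      generalize 1 - x ^ 2 * (x ^ 2) ^ (2 * n + 1) = v at *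
      field_simp
      ring

/-- The Jacobi triple product identity. -/
theorem tsum_thetaTerm {x a : ℂ} (hx : ‖x‖ < 1) (hx0 : x ≠ 0) (ha : a ≠ 0) :
    ∑' k, thetaTerm x a k =
      qPochInf (-(a * x)) (x ^ 2) * qPochInf (-(x / a)) (x ^ 2) * qPochInf (x ^ 2) (x ^ 2) := by
  have hp : ‖x ^ 2‖ < 1 := by
    rw [norm_pow]
    exact pow_lt_one₀ (norm_nonneg x) hx two_ne_zero
  obtain ⟨C, h0, hC⟩ := exists_norm_invQFact_le hp
  have hlim : Tendsto (fun n : ℕ => ∑' k : ℤ,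
      thetaTerm x a k * (invQFact (x ^ 2) (n + k) * invQFact (x ^ 2) (n - k))) atTop
      (𝓝 (∑' k : ℤ, thetaTerm x a k *
        ((qPochInf (x ^ 2) (x ^ 2))⁻¹ * (qPochInf (x ^ 2) (x ^ 2))⁻¹))) := by
    refine tendsto_tsum_of_dominated_convergence
      ((summable_thetaTerm hx a).norm.mul_right (C * C)) (fun k => ?_)
      (.of_forall fun n k => ?_)
    · refine ((tendsto_invQFact hp ?_).mul (tendsto_invQFact hp ?_)).const_mul _
      · exact tendsto_atTop_add_const_right _ k tendsto_natCast_atTop_atTop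
      · exact tendsto_atTop_add_const_right _ (-k) tendsto_natCast_atTop_atTop
    · rw [norm_mul, norm_mul]
      have h1 := hC (n + k)
      have h2 := hC (n - k)
      gcongr
  simp only [fun n : ℕ => (hasSum_thetaTerm_mul_invQFact hx hx0 ha n).tsum_eq] at hlim
  have hlim' := ((tendsto_qPoch (-(a * x)) hp).mul (tendsto_qPoch (-(x / a)) hp)).div
    ((tendsto_qPoch (x ^ 2) hp).comp (tendsto_id.const_mul_atTop' two_pos))
    (qPochInf_self_ne_zero hp)
  have h := tendsto_nhds_unique hlim hlim'
  have hL := qPochInf_self_ne_zero hp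
  rw [tsum_mul_right] at h
  field_simp at h
  rw [h, mul_comm x a]
  ring

/-! ### Ramanujan's series as a theta series -/

theorem ramanujan_tsum_thetaTerm {x a : ℂ} (hx : ‖x‖ < 1) (hx0 : x ≠ 0) (ha : a ≠ 0) :
    Summable (fun n : ℕ => ramanujanTerm x a n) ∧
      ∑' n : ℕ, ramanujanTerm x a n =
        (∑' k, thetaTerm (x ^ 3) a k) / qPochInf (x ^ 2) (x ^ 2) := by
  have hp : ‖x ^ 2‖ < 1 := by
    rw [norm_pow]
    exact pow_lt_one₀ (norm_nonneg x) hx two_ne_zero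
  obtain ⟨C, h0, hC⟩ := exists_norm_invQFact_le hp
  have hterm : ∀ n : ℕ, ramanujanTerm x a n = ∑' k : ℤ, (x ^ 2) ^ (n * n) *
      (thetaTerm x a k * (invQFact (x ^ 2) (n + k) * invQFact (x ^ 2) (n - k))) := fun n => by
    rw [tsum_mul_left, (hasSum_thetaTerm_mul_invQFact hx hx0 ha n).tsum_eq, ramanujanTerm,
      ← pow_mul, sq n, mul_assoc (x ^ _), mul_div_assoc]
  -- Bounded reciprocals leave a product of two summable families as majorant, which justifies
  -- interchanging the sums.
  have hsum : Summable (Function.uncurry fun (n : ℕ) (k : ℤ) => (x ^ 2) ^ (n * n) *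
      (thetaTerm x a k * (invQFact (x ^ 2) (n + k) * invQFact (x ^ 2) (n - k)))) := by
    have h1 : Summable fun n : ℕ => ‖(x ^ 2) ^ (n * n)‖ := by
      simpa using (summable_pow_sq_mul_pow hp 1).norm
    refine .of_norm_bounded ((h1.mul_of_nonneg ((summable_thetaTerm hx a).norm.mul_right (C * C))
      (fun _ => norm_nonneg _) (fun _ => by positivity))) fun ⟨n, k⟩ => ?_
    simp only [Function.uncurry, norm_mul]
    have h1 := hC (n + k)
    have h2 := hC (n - k)
    gcongr
  constructor
  · simp only [hterm]
    exact hsum.prod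
  · simp only [hterm]
    rw [← hsum.tsum_comm, ← tsum_div_const]
    refine tsum_congr fun k => ?_
    simp only [mul_left_comm _ (thetaTerm x a k)]
    rw [tsum_mul_left, tsum_pow_sq_mul_invQFact hp, thetaTerm, thetaTerm, ← zpow_natCast,
      ← zpow_natCast x 2, ← zpow_natCast x 3, ← zpow_mul, ← zpow_mul, Nat.cast_mul,
      Int.natAbs_mul_self', show ((3 : ℕ) : ℤ) * (k * k) = k * k + ((2 : ℕ) : ℤ) * (k * k) by
        push_cast; ring, zpow_add₀ hx0]
    ring

/-! ### Dissection modulo `m` -/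

theorem tsum_int_eq_sum_residues (m : ℕ) (hm : 0 < m) {f : ℤ → ℂ} (hf : Summable f) :
    ∑' N, f N = ∑ r ∈ Finset.range m, ∑' k : ℤ, f (k * m + r) := by
  have : NeZero m := ⟨hm.ne'⟩
  let e : ℤ ≃ Fin m × ℤ := (Int.divModEquiv m).trans (Equiv.prodComm _ _)
  have hs : Summable fun p => f (e.symm p) := e.symm.summable_iff.2 hf
  rw [← e.symm.tsum_eq, hs.tsum_prod, tsum_fintype, Finset.sum_range]
  rfl

theorem innerTerm_eq_ramanujanTerm {q s : ℂ} (hs : s ^ 2 = q) (m : ℕ) (z : ℂ) (r n : ℕ) :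
    innerTerm m q s z r n =
      ramanujanTerm (s ^ (m ^ 2)) (z ^ m * s ^ (3 * (m : ℤ) * (2 * (r : ℤ) - 1))) n := by
  subst hs
  simp only [innerTerm, ramanujanTerm, paramA, paramB]
  rw [show (s ^ 2) ^ (m ^ 2) = (s ^ (m ^ 2)) ^ 2 by ring,
    show (s ^ 2) ^ (m ^ 2 * n ^ 2) = (s ^ (m ^ 2)) ^ (2 * n ^ 2) by ring]
  generalize s ^ (3 * (m : ℤ) * (2 * (r : ℤ) - 1)) = w
  rw [show s ^ m ^ 2 * z ^ m * w = z ^ m * w * s ^ m ^ 2 by ring]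
  ring

theorem thetaTerm_residue {s z : ℂ} (hs : s ≠ 0) (hz : z ≠ 0) (m r : ℕ) (k : ℤ) :
    thetaTerm (s ^ 3) (z / s ^ 3) (k * m + r) =
      (s ^ 2) ^ (3 * (r * (r - 1)) / 2) * z ^ r *
        thetaTerm ((s ^ (m ^ 2)) ^ 3) (z ^ m * s ^ (3 * (m : ℤ) * (2 * (r : ℤ) - 1))) k := by
  -- The truncated `r - 1` at `r = 0` is harmless because of the factor `r`, and the halving is
  -- exact.
  have hr : (s ^ 2) ^ (3 * (r * (r - 1)) / 2) = s ^ (3 * (r : ℤ) * (r - 1)) := by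
    rw [← pow_mul, Nat.mul_div_cancel' ((Nat.even_mul_pred_self r).two_dvd.mul_left 3),
      ← zpow_natCast]
    rcases r with _ | r
    · simp
    · push_cast [Nat.add_sub_cancel]
      ring_nf
  rw [hr, thetaTerm, thetaTerm, ← pow_mul]
  simp only [← zpow_natCast]
  rw [div_zpow, mul_zpow, zpow_add₀ hz, mul_comm k (m : ℤ), zpow_mul z]
  simp only [← zpow_mul]
  have : s ^ (((3 : ℕ) : ℤ) * ((m * k + r) * (m * k + r))) =
      s ^ (3 * (r : ℤ) * (r - 1)) * s ^ (((m ^ 2 * 3 : ℕ) : ℤ) * (k * k)) *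
        s ^ (3 * (m : ℤ) * (2 * (r : ℤ) - 1) * k) * s ^ (((3 : ℕ) : ℤ) * (m * k + r)) := by
    rw [← zpow_add₀ hs, ← zpow_add₀ hs, ← zpow_add₀ hs]
    congr 1
    push_cast
    ring
  rw [this]
  have h3 : s ^ (((3 : ℕ) : ℤ) * (m * k + r)) ≠ 0 := zpow_ne_zero _ hs
  field_simp

theorem qPochInf_zero (A : ℂ) : qPochInf A 0 = 1 - A := by
  rw [qPochInf, tprod_eq_mulSingle 0 fun k hk => by simp [hk]]
  simp

theorem ramanujanTerm_zero (a : ℂ) : ramanujanTerm 0 a = fun n => if n = 0 then 1 else 0 := by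
  funext n
  split_ifs with h
  · simp [h, ramanujanTerm, qPoch]
  · simp [h, ramanujanTerm]

/-- The infinite family of identities, for any choice `s` of `q ^ (1 / 2)`, together with
Ramanujan's identity, which is its member `m = 1` with `q = x ^ 2`, `z = a * x ^ 3`. -/
theorem mainTheorem6 :
    (∀ (m : ℕ) (q s z : ℂ), 0 < m → z ≠ 0 → q ≠ 0 → ‖q‖ < 1 → s ^ 2 = q →
      (∀ r ∈ Finset.range m, Summable fun n : ℕ => innerTerm m q s z r n) ∧
      ∑ r ∈ Finset.range m,
          q ^ (3 * (r * (r - 1)) / 2) * z ^ r * ∑' n : ℕ, innerTerm m q s z r n =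
        qPochInf (-z) (q ^ 3) * qPochInf (-(q ^ 3 / z)) (q ^ 3) * qPochInf (q ^ 3) (q ^ 3) /
          qPochInf (q ^ (m ^ 2)) (q ^ (m ^ 2))) ∧
    (∀ x a : ℂ, a ≠ 0 → ‖x‖ < 1 →
      (Summable fun n : ℕ => ramanujanTerm x a n) ∧
      ∑' n : ℕ, ramanujanTerm x a n =
        qPochInf (-(a * x ^ 3)) (x ^ 6) * qPochInf (-(x ^ 3 / a)) (x ^ 6) *
            qPochInf (x ^ 6) (x ^ 6) /
          qPochInf (x ^ 2) (x ^ 2)) := by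
  refine ⟨fun m q s z hm hz hq hq1 hs => ?_, fun x a ha hx => ?_⟩
  · have hs0 : s ≠ 0 := by
      rintro rfl
      exact hq (by rw [← hs]; simp)
    have hs1 : ‖s‖ < 1 := by
      rw [← hs, norm_pow] at hq1
      exact lt_of_pow_lt_pow_left₀ 2 zero_le_one (by simpa using hq1)
    have hx : ‖s ^ (m ^ 2)‖ < 1 := by
      rw [norm_pow]
      exact pow_lt_one₀ (norm_nonneg s) hs1 (by positivity)
    have ha : ∀ r : ℕ, z ^ m * s ^ (3 * (m : ℤ) * (2 * (r : ℤ) - 1)) ≠ 0 := fun r =>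
      mul_ne_zero (pow_ne_zero _ hz) (zpow_ne_zero _ hs0)
    have key := fun r => ramanujan_tsum_thetaTerm hx (pow_ne_zero _ hs0) (ha r)
    simp only [innerTerm_eq_ramanujanTerm hs]
    refine ⟨fun r _ => (key r).1, ?_⟩
    simp only [fun r => (key r).2]
    have h3 : ‖s ^ 3‖ < 1 := by
      rw [norm_pow]
      exact pow_lt_one₀ (norm_nonneg s) hs1 three_ne_zero
    have hs3 : s ^ 3 ≠ 0 := pow_ne_zero 3 hs0
    -- With base `s ^ 3`, the argument `z / s ^ 3` makes the two product parameters `-z` and `-(q ^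
    -- 3 / z)`.
    have hJ := tsum_thetaTerm h3 hs3 (div_ne_zero hz hs3)
    rw [div_mul_cancel₀ _ hs3, div_div_eq_mul_div, ← sq,
      show (s ^ 3) ^ 2 = q ^ 3 by rw [← hs]; ring] at hJ
    rw [← hJ, tsum_int_eq_sum_residues m hm (summable_thetaTerm h3 _), Finset.sum_div]
    refine Finset.sum_congr rfl fun r _ => ?_
    simp only [thetaTerm_residue hs0 hz]
    rw [tsum_mul_left, hs, show (s ^ (m ^ 2)) ^ 2 = q ^ (m ^ 2) by rw [← hs]; ring, mul_div_assoc]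
  · rcases eq_or_ne x 0 with rfl | hx0
    -- At `x = 0` only the term `n = 0` survives, and both sides equal `1`.
    · rw [ramanujanTerm_zero]
      exact ⟨(hasSum_ite_eq 0 1).summable, by simp [qPochInf_zero]⟩
    · have h3 : ‖x ^ 3‖ < 1 := by
        rw [norm_pow]
        exact pow_lt_one₀ (norm_nonneg x) hx three_ne_zero
      have h := ramanujan_tsum_thetaTerm hx hx0 ha
      rw [tsum_thetaTerm h3 (pow_ne_zero 3 hx0) ha, ← pow_mul] at h
      exact h
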